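/- **Setting.** Let $M$ be a proper CAT(0) space. Its boundary $\partial M$ is the set of asymptoty classes $\gamma(\infty)$ of geodesic rays $\gamma:[0,\infty)\to M$, with the cone topology (the compact-open topology on the geodesic rays emanating from a base point $a\in M$, transported to $\partial M$ along $\gamma\mapsto\gamma(\infty)$). For a geodesic ray $\gamma$ let $\beta_\gamma(b)=\lim_{t\to\infty}\bigl(d(\gamma(0),\gamma(t))-d(b,\gamma(t))\bigr)$ be its Busemann function and, for $s\in\mathbb R$, let $HB_s(\gamma)=\beta_\gamma^{-1}([s,\infty))$ be the associated horoballs. Let $G$ be a group, $n\ge 0$ an integer, and $\rho:G\to\mathrm{Isom}(M)$ an isometric action. Let $X$ be a CW-complex of dimension at most $n$ that is $(n-1)$-connected (in particular non-empty), on which $G$ acts by homeomorphisms permuting the cells freely, with finitely many orbits of cells. Let $h:X\to M$ be a continuous $G$-map. For a geodesic ray $\gamma$ and $s\in\mathbb R$ let $X_{(\gamma,s)}$ be the largest subcomplex of $X$ contained in $h^{-1}(HB_s(\gamma))$. We say that $X$ is *controlled $(n-1)$-connected* ($CC^{n-1}$) in the direction $\gamma$ if every $X_{(\gamma,s)}$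 is non-empty and, for all $s\in\mathbb R$ and $0\le p\le n-1$, there is $\lambda\ge 0$ such that every map $S^p\to X_{(\gamma,s)}$ extends to a map $B^{p+1}\to X_{(\gamma,s-\lambda)}$. The action $\rho$ is $CC^{n-1}$ over $e\in\partial M$ if there are $X$, $h$ and a geodesic ray $\gamma$ with $\gamma(\infty)=e$, as above, such that $X$ is $CC^{n-1}$ in the direction $\gamma$. (Such an $X$ exists if and only if $G$ is of type $F_n$, and the property is known not to depend on the choice of $X$, $h$ and $\gamma$.) Put $$\Sigma^n(\rho)=\{e\in\partial M\mid \rho\text{ is }CC^{n-1}\text{ over }e\},\qquad \overset{\circ}{\Sigma}{}^n(\rho)=\{e\in\partial M\mid \mathrm{cl}_{\partial M}(Ge)\subseteq\Sigma^n(\rho)\}.$$ Let $S(G)$ be the set of classes $[\chi]$ of non-zero homomorphisms $\chi:G\to\mathbb R$ modulo positive scalar multiplication, and let $\Sigma^n(G)\subseteq S(G)$ be the set of all $[\chi]$ such that the translation action $g\cdot r=r+\chi(g)$ of $G$ on $\mathbb R$ is $CC^{n-1}$ over the endpoint $\infty$ of $\mathbb R$ (the Bieri-Neumann-Strebel-Renz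 invariant). For $e\in\partial M$ let $\mathrm{Isom}(M,e)$ be the group of isometries of $M$ that fix $e$, and let $\kappa:\mathrm{Isom}(M,e)\to\mathbb R$ be the homomorphism $\kappa(f)=\beta_\gamma(f(a))-\beta_\gamma(a)$, where $\gamma(\infty)=e$ and $a\in M$; it does not depend on the choice of $\gamma$ and $a$. **Theorem I.** Let $\rho:G\to\mathrm{Isom}(M,e)$ be an action fixing the point $e\in\partial M$, and let $\chi_{\rho,e}=\kappa\rho:G\to\mathbb R$ be the induced character. Then $e\in\Sigma^n(\rho)$ if and only if $\kappa\rho\neq 0$ and $[\kappa\rho]\in\Sigma^n(G)$. Moreover, $e\in\overset{\circ}{\Sigma}{}^n(\rho)$ if and only if $e\in\Sigma^n(\rho)$. -/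

import Mathlib

open Set Metric Filter Topology
open scoped NNReal

noncomputable section

namespace GeomInv

universe u v

/-! ## CAT(0) spaces -/

/-- `c`, restricted to `[0, 1]`, is a geodesic segment from `p` to `q`, parametrised
proportionally to arc length. -/
def IsGeodesicSegment {M : Type v} [MetricSpace M] (c : ℝ → M) (p q : M) : Prop :=
  c 0 = p ∧ c 1 = q ∧
    ∀ s ∈ Icc (0 : ℝ) 1, ∀ t ∈ Icc (0 : ℝ) 1, dist (c s) (c t) = |s - t| * dist p q

/-- CAT(0) spaces: geodesic metric spaces in which the distance of two points on two sides
`[p, q]`, `[p, r]` of a geodesic triangle is at most the distance of the corresponding points of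
a comparison triangle in the Euclidean plane (which is unique up to isometry). -/
class CAT0Space (M : Type v) [MetricSpace M] : Prop where
  exists_geodesic : ∀ p q : M, ∃ c : ℝ → M, IsGeodesicSegment c p q
  comparison : ∀ (p q r : M) (c₁ c₂ : ℝ → M), IsGeodesicSegment c₁ p q →
    IsGeodesicSegment c₂ p r → ∃ p' q' r' : EuclideanSpace ℝ (Fin 2),
      dist p' q' = dist p q ∧ dist p' r' = dist p r ∧ dist q' r' = dist q r ∧
      ∀ s ∈ Icc (0 : ℝ) 1, ∀ t ∈ Icc (0 : ℝ) 1,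
        dist (c₁ s) (c₂ t) ≤ dist (AffineMap.lineMap p' q' s) (AffineMap.lineMap p' r' t)

/-! ## The boundary at infinity -/

/-- Geodesic rays `[0, ∞) → M`, with the compact-open topology. -/
abbrev GeodesicRay (M : Type v) [MetricSpace M] : Type v := {γ : C(ℝ≥0, M) // Isometry γ}

/-- Two geodesic rays are asymptotic if they stay at bounded distance. -/
def Asymptotic {M : Type v} [MetricSpace M] (γ γ' : GeodesicRay M) : Prop :=
  ∃ r : ℝ, ∀ t, dist (γ.1 t) (γ'.1 t) ≤ r

theorem Asymptotic.symm {M : Type v} [MetricSpace M] {γ γ' : GeodesicRay M}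
    (h : Asymptotic γ γ') : Asymptotic γ' γ := by
  obtain ⟨r, hr⟩ := h
  exact ⟨r, fun t => by rw [dist_comm]; exact hr t⟩

/-- The equivalence relation of being asymptotic. -/
instance asymptoticSetoid (M : Type v) [MetricSpace M] : Setoid (GeodesicRay M) where
  r := Asymptotic
  iseqv := ⟨fun γ => ⟨0, fun t => by simp⟩, fun h => h.symm, fun {a b c} h h' => by
    obtain ⟨r, hr⟩ := h
    obtain ⟨r', hr'⟩ := h'
    exact ⟨r + r', fun t => (dist_triangle _ (b.1 t) _).trans (add_le_add (hr t) (hr' t))⟩⟩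

/-- The boundary `∂M`: asymptoty classes of geodesic rays. -/
def Boundary (M : Type v) [MetricSpace M] : Type v := Quotient (asymptoticSetoid M)

/-- The endpoint `γ(∞)` of a geodesic ray. -/
def endpoint {M : Type v} [MetricSpace M] (γ : GeodesicRay M) : Boundary M := Quotient.mk _ γ

/-- The cone topology on `∂M`, seen from the base point `a`: the compact-open topology on the set
of geodesic rays emanating from `a`, transported along `γ ↦ γ(∞)` (a bijection onto `∂M` when `M`
is a proper CAT(0) space; the result is then independent of `a`). -/
@[reducible] def coneTopology {M : Type v} [MetricSpace M] (a : M) :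
    TopologicalSpace (Boundary M) :=
  TopologicalSpace.coinduced
    (fun γ : {γ : GeodesicRay M // γ.1 0 = a} => endpoint γ.1) inferInstance

/-- The image of a geodesic ray under an isometry. -/
def mapRay {M : Type v} [MetricSpace M] (f : M ≃ᵢ M) (γ : GeodesicRay M) : GeodesicRay M :=
  ⟨⟨fun t => f (γ.1 t), f.continuous.comp γ.1.continuous⟩, f.isometry.comp γ.2⟩

/-- The action of the isometry group of `M` on `∂M`. -/
instance boundaryAction (M : Type v) [MetricSpace M] : MulAction (M ≃ᵢ M) (Boundary M) where
  smul f := Quotient.map (mapRay f) (fun _ _ h => by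
    obtain ⟨r, hr⟩ := h
    exact ⟨r, fun t => (f.dist_eq _ _).le.trans (hr t)⟩)
  one_smul e := by
    induction e using Quotient.inductionOn
    rfl
  mul_smul f g e := by
    induction e using Quotient.inductionOn
    rfl

/-- `Isom(M, e)`, the group of isometries of `M` which fix the point `e` of `∂M`. -/
abbrev IsomFixing {M : Type v} [MetricSpace M] (e : Boundary M) : Subgroup (M ≃ᵢ M) :=
  MulAction.stabilizer (M ≃ᵢ M) e

/-! ## Busemann functions and horoballs -/

/-- The Busemann function `β_γ(b) = lim_{t → ∞} (d(γ(0), γ(t)) - d(b, γ(t)))`. -/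
def busemann {M : Type v} [MetricSpace M] (γ : GeodesicRay M) (b : M) : ℝ :=
  limUnder atTop (fun t : ℝ≥0 => dist (γ.1 0) (γ.1 t) - dist b (γ.1 t))

/-- The horoball `HB_s(γ)`. -/
def horoball {M : Type v} [MetricSpace M] (γ : GeodesicRay M) (s : ℝ) : Set M :=
  {b | s ≤ busemann γ b}

/-! ## The Busemann character -/

theorem dist_ray {M : Type v} [MetricSpace M] (γ : GeodesicRay M) (s t : ℝ≥0) :
    dist (γ.1 s) (γ.1 t) = |(s : ℝ) - t| := by
  rw [γ.2.dist_eq, NNReal.dist_eq]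

/-- The limit in the definition of the Busemann function exists. -/
theorem tendsto_busemann {M : Type v} [MetricSpace M] (γ : GeodesicRay M) (b : M) :
    Tendsto (fun t : ℝ≥0 => dist (γ.1 0) (γ.1 t) - dist b (γ.1 t)) atTop
      (𝓝 (busemann γ b)) := by
  have hmono : Monotone (fun t : ℝ≥0 => dist (γ.1 0) (γ.1 t) - dist b (γ.1 t)) := by
    intro s t hst
    have hst' : (s : ℝ) ≤ t := by exact_mod_cast hst
    have h1 := dist_triangle b (γ.1 s) (γ.1 t)
    have h2 := dist_ray γ 0 s
    have h3 := dist_ray γ 0 t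
    have h4 := dist_ray γ s t
    have hs := s.2
    rw [abs_sub_comm, abs_of_nonneg (by simp)] at h2 h3
    rw [abs_sub_comm, abs_of_nonneg (by linarith)] at h4
    simp only [NNReal.coe_zero] at h2 h3
    simp only
    linarith
  have hbdd : BddAbove (range (fun t : ℝ≥0 => dist (γ.1 0) (γ.1 t) - dist b (γ.1 t))) := by
    refine ⟨dist (γ.1 0) b, ?_⟩
    rintro _ ⟨t, rfl⟩
    have := dist_triangle (γ.1 0) b (γ.1 t)
    simp only
    linarith
  have h := tendsto_atTop_ciSup hmono hbdd
  rw [busemann, h.limUnder_eq]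
  exact h

theorem quadrilateral {M : Type v} [MetricSpace M] [CAT0Space M] (x y z w : M) :
    dist x w ^ 2 + dist y z ^ 2 ≤
      dist x y ^ 2 + dist y w ^ 2 + dist w z ^ 2 + dist z x ^ 2 := by
  obtain ⟨c, hc⟩ := CAT0Space.exists_geodesic x w
  have key : ∀ p : M, dist p (c (1 / 2)) ^ 2 ≤
      dist x p ^ 2 / 2 + dist p w ^ 2 / 2 - dist x w ^ 2 / 4 := by
    intro p
    obtain ⟨c', hc'⟩ := CAT0Space.exists_geodesic x p
    obtain ⟨x', w', p', h1, h2, h3, h⟩ := CAT0Space.comparison x w p c c' hc hc'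
    have h4 := h (1 / 2) ⟨by norm_num, by norm_num⟩ 1 ⟨by norm_num, by norm_num⟩
    rw [hc'.2.1, AffineMap.lineMap_apply_one] at h4
    have h5 : (AffineMap.lineMap x' w' (1 / 2 : ℝ)) = midpoint ℝ x' w' := by
      rw [midpoint, one_div, invOf_eq_inv]
    have h6 := EuclideanGeometry.dist_sq_add_dist_sq_eq_two_mul_dist_midpoint_sq_add_half_dist_sq
      p' x' w'
    rw [h5, dist_comm, dist_comm (midpoint ℝ x' w')] at h4
    rw [dist_comm p' x', h2, dist_comm p' w', h3, h1, dist_comm w p] at h6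
    have h7 := pow_le_pow_left₀ dist_nonneg h4 2
    nlinarith
  have hy := key y
  have hz := key z
  have h := dist_triangle_right y z (c (1 / 2))
  have h' := pow_le_pow_left₀ dist_nonneg h 2
  have h'' := sq_nonneg (dist y (c (1 / 2)) - dist z (c (1 / 2)))
  rw [dist_comm z x, dist_comm w z]
  nlinarith

/-- The Busemann functions of asymptotic rays differ by a constant. -/
theorem busemann_sub_eq {M : Type v} [MetricSpace M] [CAT0Space M] {γ γ' : GeodesicRay M}
    (h : Asymptotic γ γ') (x y : M) :
    busemann γ x - busemann γ y = busemann γ' x - busemann γ' y := by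
  have main : ∀ γ γ' : GeodesicRay M, Asymptotic γ γ' →
      busemann γ x - busemann γ y ≤ busemann γ' x - busemann γ' y := by
    rintro γ γ' ⟨r, hr⟩
    have hcoe : Tendsto (fun t : ℝ≥0 => (t : ℝ)) atTop atTop :=
      NNReal.tendsto_coe_atTop.2 tendsto_id
    have hA : ∀ γ : GeodesicRay M, Tendsto (fun t => dist x (γ.1 t) - dist y (γ.1 t)) atTop
        (𝓝 (busemann γ y - busemann γ x)) := fun γ =>
      ((tendsto_busemann γ y).sub (tendsto_busemann γ x)).congr fun t => by ring
    have hq : ∀ (γ : GeodesicRay M) (b : M),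
        Tendsto (fun t : ℝ≥0 => dist b (γ.1 t) / t) atTop (𝓝 1) := by
      intro γ b
      have h1 := ((tendsto_busemann γ b).div_atTop hcoe).const_sub 1
      rw [sub_zero] at h1
      refine h1.congr' ?_
      filter_upwards [eventually_gt_atTop 0] with t ht
      have ht' : (0 : ℝ) < t := ht
      rw [dist_ray, abs_sub_comm, NNReal.coe_zero, sub_zero, abs_of_pos ht']
      field_simp
      ring
    have hS : ∀ γ : GeodesicRay M,
        Tendsto (fun t : ℝ≥0 => (dist x (γ.1 t) - dist y (γ.1 t)) *
          (dist x (γ.1 t) / t + dist y (γ.1 t) / t)) atTop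
          (𝓝 ((busemann γ y - busemann γ x) * (1 + 1))) := fun γ =>
      (hA γ).mul ((hq γ x).add (hq γ y))
    have hC : Tendsto (fun t : ℝ≥0 => (dist x y ^ 2 + r ^ 2) / (t : ℝ)) atTop (𝓝 0) :=
      tendsto_const_nhds.div_atTop hcoe
    have hle := le_of_tendsto_of_tendsto ((hS γ').sub (hS γ)) hC (by
      filter_upwards [eventually_gt_atTop 0] with t ht
      have ht' : (0 : ℝ) < t := ht
      have hquad := quadrilateral x y (γ.1 t) (γ'.1 t)
      have hrt : dist (γ'.1 t) (γ.1 t) ^ 2 ≤ r ^ 2 := by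
        rw [dist_comm]
        exact pow_le_pow_left₀ dist_nonneg (hr t) 2
      rw [dist_comm (γ.1 t) x] at hquad
      rw [← add_div, ← add_div, mul_div_assoc', mul_div_assoc', ← sub_div]
      refine div_le_div_of_nonneg_right ?_ ht'.le
      nlinarith)
    linarith
  exact le_antisymm (main γ γ' h) (main γ' γ h.symm)

theorem busemann_mapRay {M : Type v} [MetricSpace M] (f : M ≃ᵢ M) (γ : GeodesicRay M) (b : M) :
    busemann (mapRay f γ) (f b) = busemann γ b := by
  have : ∀ t, dist ((mapRay f γ).1 0) ((mapRay f γ).1 t) - dist (f b) ((mapRay f γ).1 t) =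
      dist (γ.1 0) (γ.1 t) - dist b (γ.1 t) := fun t => by
    change dist (f (γ.1 0)) (f (γ.1 t)) - dist (f b) (f (γ.1 t)) = _
    rw [f.dist_eq, f.dist_eq]
  simp only [busemann, this]

/-- The displacement `β_γ(f a) - β_γ(a)` of an isometry `f` fixing `e` depends neither on the
point `a` nor on the ray `γ` representing `e`. -/
theorem busemann_displacement {M : Type v} [MetricSpace M] [CAT0Space M] {f : M ≃ᵢ M}
    {γ γ' : GeodesicRay M} (h : Asymptotic γ γ') (hf : Asymptotic (mapRay f γ) γ) (a b : M) :
    busemann γ (f a) - busemann γ a = busemann γ' (f b) - busemann γ' b := by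
  have h1 := busemann_sub_eq hf (f a) (f b)
  rw [busemann_mapRay, busemann_mapRay] at h1
  have h2 := busemann_sub_eq h (f b) b
  linarith

theorem asymptotic_mapRay {M : Type v} [MetricSpace M] {e : Boundary M} (f : IsomFixing e)
    {γ : GeodesicRay M} (hγ : endpoint γ = e) : Asymptotic (mapRay f.1 γ) γ := by
  subst hγ
  exact Quotient.exact f.2

/-- The canonical map `κ : Isom(M, e) → ℝ`. -/
def kappa {M : Type v} [MetricSpace M] [CAT0Space M] (e : Boundary M) :
    IsomFixing e →* Multiplicative ℝ where
  toFun f := Multiplicative.ofAdd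
    (busemann (Quotient.out e) (f.1 ((Quotient.out e).1 0)) -
      busemann (Quotient.out e) ((Quotient.out e).1 0))
  map_one' := by simp
  map_mul' f g := by
    have hf := asymptotic_mapRay f (Quotient.out_eq e)
    have h := busemann_displacement (Setoid.refl (Quotient.out e)) hf
      (g.1 ((Quotient.out e).1 0)) ((Quotient.out e).1 0)
    rw [← ofAdd_add, ← h]
    congr 1
    simp only [Subgroup.coe_mul, IsometryEquiv.mul_apply]
    ring

/-- For every ray `γ` representing `e`, the isometry `f` moves the horoballs at `e` by `κ(f)`. -/
theorem busemann_kappa {M : Type v} [MetricSpace M] [CAT0Space M] {e : Boundary M}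
    (f : IsomFixing e) {γ : GeodesicRay M} (hγ : endpoint γ = e) (a : M) :
    busemann γ (f.1 a) = busemann γ a + (kappa e f).toAdd := by
  have h := busemann_displacement
    (Quotient.exact (hγ.trans (Quotient.out_eq e).symm)) (asymptotic_mapRay f hγ) a
    ((Quotient.out e).1 0)
  change _ = busemann γ a + (_ - _)
  linarith

/-! ## Free G-CW-complexes -/

/-- Every map `S^p → A` extends to a map `B^{p+1} → B`, for subsets `A ⊆ B` of `X`. -/
def SpheresFill {X : Type u} [TopologicalSpace X] (p : ℕ) (A B : Set X) : Prop :=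
  ∀ f : C(sphere (0 : EuclideanSpace ℝ (Fin (p + 1))) 1, X), (∀ x, f x ∈ A) →
    ∃ F : C(closedBall (0 : EuclideanSpace ℝ (Fin (p + 1))) 1, X), (∀ x, F x ∈ B) ∧
      ∀ x, F (inclusion sphere_subset_closedBall x) = f x

/-- An `n`-dimensional `(n-1)`-connected free `G`-CW-complex with finitely many orbits of cells:
a CW-complex on which `G` acts by homeomorphisms which permute the cells freely. -/
structure FreeGCW (G : Type u) [Group G] (n : ℕ) where
  /-- The underlying space. -/
  X : Type u
  [top : TopologicalSpace X]
  [t2 : T2Space X]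
  [cw : CWComplex (univ : Set X)]
  [act : MulAction G X]
  [cont : ContinuousConstSMul G X]
  /-- `G` permutes the cells. -/
  permutes : ∀ (g : G) (m : ℕ) (i : RelCWComplex.cell (univ : Set X) m),
    ∃ j : RelCWComplex.cell (univ : Set X) m,
      (fun x : X => g • x) '' RelCWComplex.openCell (C := (univ : Set X)) m i =
        RelCWComplex.openCell (C := (univ : Set X)) m j
  /-- The stabilizers of the cells are trivial. -/
  free : ∀ (g : G) (m : ℕ) (i : RelCWComplex.cell (univ : Set X) m),
    (fun x : X => g • x) '' RelCWComplex.openCell (C := (univ : Set X)) m i =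
      RelCWComplex.openCell (C := (univ : Set X)) m i → g = 1
  /-- There are no cells of dimension greater than `n`. -/
  dim_le : ∀ m, n < m → IsEmpty (RelCWComplex.cell (univ : Set X) m)
  /-- `G \ X` is finite. -/
  cocompact : ∀ m, ∃ F : Set (RelCWComplex.cell (univ : Set X) m), F.Finite ∧
    ∀ i, ∃ j ∈ F, ∃ g : G,
      RelCWComplex.openCell (C := (univ : Set X)) m i =
        (fun x : X => g • x) '' RelCWComplex.openCell (C := (univ : Set X)) m j
  /-- `X` is non-empty, i.e. `(-1)`-connected. -/
  nonempty : Nonempty X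
  /-- Every map `S^p → X`, `0 ≤ p ≤ n - 1`, extends to a map `B^{p+1} → X`. -/
  connected : ∀ p < n, SpheresFill p (univ : Set X) univ

attribute [instance] FreeGCW.top FreeGCW.t2 FreeGCW.cw FreeGCW.act FreeGCW.cont

/-- The largest subcomplex of a CW-complex lying in the subset `A`. -/
def largestSubcomplex {X : Type u} [TopologicalSpace X] [CWComplex (univ : Set X)] (A : Set X) :
    Set X :=
  ⋃ (E : RelCWComplex.Subcomplex (univ : Set X)) (_ : (E : Set X) ⊆ A), (E : Set X)

/-! ## Controlled connectivity and the geometric invariants -/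

/-- Control functions: continuous `G`-maps `X → M`. -/
def IsControl {G : Type u} [Group G] {M : Type v} [MetricSpace M] {n : ℕ} (ρ : G →* (M ≃ᵢ M))
    (X : FreeGCW G n) (h : C(X.X, M)) : Prop :=
  ∀ (g : G) (x : X.X), h (g • x) = ρ g (h x)

/-- The subcomplex `X_(γ,s)`. -/
def overHoroball {G : Type u} [Group G] {M : Type v} [MetricSpace M] {n : ℕ} (X : FreeGCW G n)
    (h : C(X.X, M)) (γ : GeodesicRay M) (s : ℝ) : Set X.X :=
  largestSubcomplex (h ⁻¹' horoball γ s)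

/-- `X` is controlled `(n-1)`-connected in the direction `γ`, with respect to the control
function `h`. The first condition is the case `p = -1`. -/
def IsCCInDirection {G : Type u} [Group G] {M : Type v} [MetricSpace M] {n : ℕ} (X : FreeGCW G n)
    (h : C(X.X, M)) (γ : GeodesicRay M) : Prop :=
  (∀ s, (overHoroball X h γ s).Nonempty) ∧
    ∀ (s : ℝ) (p : ℕ), p < n → ∃ lag : ℝ, 0 ≤ lag ∧
      SpheresFill p (overHoroball X h γ s) (overHoroball X h γ (s - lag))

/-- The action `ρ` is controlled `(n-1)`-connected over `e`. For groups of type `F_n` and proper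
CAT(0) spaces `M` the condition does not depend on the choice of `X`, `h` and `γ`. -/
def IsCCOver {G : Type u} [Group G] {M : Type v} [MetricSpace M] (n : ℕ) (ρ : G →* (M ≃ᵢ M))
    (e : Boundary M) : Prop :=
  ∃ (X : FreeGCW G n) (h : C(X.X, M)) (γ : GeodesicRay M),
    IsControl ρ X h ∧ endpoint γ = e ∧ IsCCInDirection X h γ

/-- The geometric invariant `Σ^n(ρ)`. -/
def SigmaAction {G : Type u} [Group G] {M : Type v} [MetricSpace M] (n : ℕ) (ρ : G →* (M ≃ᵢ M)) :
    Set (Boundary M) :=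
  {e | IsCCOver n ρ e}

/-- The dynamical subset of `Σ^n(ρ)`: the points `e` such that the closure of the orbit `Ge` in
`∂M`, with the cone topology, lies in `Σ^n(ρ)`. The base point `a` only serves to define the cone
topology. -/
def SigmaDyn {G : Type u} [Group G] {M : Type v} [MetricSpace M] (a : M) (n : ℕ)
    (ρ : G →* (M ≃ᵢ M)) : Set (Boundary M) :=
  {e | @closure (Boundary M) (coneTopology a) (range fun g : G => ρ g • e) ⊆ SigmaAction n ρ}

/-! ## The Bieri-Neumann-Strebel-Renz invariant -/

/-- Additive characters `G → ℝ`. -/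
abbrev Character (G : Type u) [Group G] : Type u := Additive G →+ ℝ

/-- The sphere `S(G)` of non-zero characters modulo positive scalar multiplication. -/
abbrev CharacterSphere (G : Type u) [Group G] : Type u := Module.Ray ℝ (Character G)

/-- The translation action of `G` on the Euclidean line given by a character. -/
def translationAction {G : Type u} [Group G] (χ : Character G) : G →* (ℝ ≃ᵢ ℝ) where
  toFun g := IsometryEquiv.addLeft (χ (Additive.ofMul g))
  map_one' := by
    ext x
    simp
  map_mul' g h := by
    ext x
    simp [add_assoc]

/-- The endpoint `∞` of the Euclidean line. -/
def lineInfty : Boundary ℝ :=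
  endpoint ⟨⟨fun t : ℝ≥0 => (t : ℝ), NNReal.continuous_coe⟩, isometry_subtype_coe⟩

/-- The homotopical geometric invariant `Σ^n(G)`: the set of all `[χ]` in `S(G)` such that `χ` is
controlled `(n-1)`-connected over `∞`. -/
def SigmaGroup (n : ℕ) (G : Type u) [Group G] : Set (CharacterSphere G) :=
  {x | ∃ (χ : Character G) (hχ : χ ≠ 0),
    x = rayOfNeZero ℝ χ hχ ∧ IsCCOver n (translationAction χ) lineInfty}

/-- The character `χ_{ρ,e} = κρ` induced by an action `ρ` fixing `e`. -/
def inducedCharacter {G : Type u} [Group G] {M : Type v} [MetricSpace M] [CAT0Space M]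
    {e : Boundary M} (ρ : G →* IsomFixing e) : Character G :=
  MonoidHom.toAdditiveLeft ((kappa e).comp ρ)

end GeomInv

end

open GeomInv

namespace GeomInv

universe u v

/-! Write χ = κρ. Since `G` fixes `e`, the height β_γ ∘ h of a control function h : X → M satisfies
β_γ(h(gx)) = β_γ(h(x)) + χ(g) (`busemann_smul`), so it is a control function for the translation
action of χ on the line, with the same superlevel sets. This transfers controlled connectivity from
`M` to ℝ on the same complex X. If χ were zero, the height would be invariant, hence bounded by
cocompactness, and some X_(γ,s) would be empty.

Conversely, a complex with a control function h' to ℝ needs a `G`-map h to `M`; barycenters of orbit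
points provide one (`exists_isControl`). A positive multiple of the height of h' then differs from
that of h by a continuous invariant function, which is bounded (`exists_abs_le_of_invariant`), and a
bounded change of height only enlarges the lag (`IsCCInDirection.of_abs_sub_le`). X is never
changed, so independence of its choice is not needed.

The dynamical statement holds because the orbit of `e` is {e}, and points of the boundary are
closed. -/

/-! ## CAT(0) geometry -/

/-- The CN inequality of Bruhat and Tits. -/
theorem exists_midpoint_dist_sq_le {M : Type v} [MetricSpace M] [CAT0Space M] (x w : M) :
    ∃ m : M, ∀ p : M,
      dist m p ^ 2 ≤ dist x p ^ 2 / 2 + dist w p ^ 2 / 2 - dist x w ^ 2 / 4 := by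
  obtain ⟨c, hc⟩ := CAT0Space.exists_geodesic x w
  refine ⟨c (1 / 2), fun p => ?_⟩
  obtain ⟨c', hc'⟩ := CAT0Space.exists_geodesic x p
  obtain ⟨x', w', p', h1, h2, h3, h⟩ := CAT0Space.comparison x w p c c' hc hc'
  have h4 := h (1 / 2) ⟨by norm_num, by norm_num⟩ 1 ⟨by norm_num, by norm_num⟩
  rw [hc'.2.1, AffineMap.lineMap_apply_one] at h4
  have h5 : (AffineMap.lineMap x' w' (1 / 2 : ℝ)) = midpoint ℝ x' w' := by
    rw [midpoint, one_div, invOf_eq_inv]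
  have h6 := EuclideanGeometry.dist_sq_add_dist_sq_eq_two_mul_dist_midpoint_sq_add_half_dist_sq
    p' x' w'
  rw [h5, dist_comm (midpoint ℝ x' w')] at h4
  rw [dist_comm p' x', h2, dist_comm p' w', h3, h1] at h6
  have h7 := pow_le_pow_left₀ dist_nonneg h4 2
  nlinarith

theorem isGeodesicSegment_ray {M : Type v} [MetricSpace M] (γ : GeodesicRay M) (T : ℝ≥0) :
    IsGeodesicSegment (fun s : ℝ => γ.1 (s.toNNReal * T)) (γ.1 0) (γ.1 T) := by
  refine ⟨by simp, by simp, fun s hs t ht => ?_⟩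
  simp only [dist_ray, NNReal.coe_mul, NNReal.coe_zero, Real.coe_toNNReal _ hs.1,
    Real.coe_toNNReal _ ht.1]
  rw [← sub_mul, abs_mul, zero_sub, abs_neg]

/-- A geodesic ray in a CAT(0) space is determined by its origin and its endpoint. -/
theorem eq_of_asymptotic {M : Type v} [MetricSpace M] [CAT0Space M] {γ γ' : GeodesicRay M}
    (h : Asymptotic γ γ') (h0 : γ.1 0 = γ'.1 0) : γ = γ' := by
  obtain ⟨r, hr⟩ := h
  apply Subtype.ext
  ext t
  -- Compare with the triangle on γ(0), γ(T), γ'(T): the side opposite γ(0) has length at most `r`,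
  -- and at parameter t/T the two other sides are at distance at most (t/T) r. Then let T tend to
  -- infinity.
  have key : ∀ T : ℝ≥0, t ≤ T → 0 < T → dist (γ.1 t) (γ'.1 t) ≤ t * r / T := by
    intro T htT hT
    have hT' : (0 : ℝ) < T := hT
    have hs : ((t : ℝ) / T) ∈ Icc (0 : ℝ) 1 :=
      ⟨by positivity, (div_le_one hT').2 (by exact_mod_cast htT)⟩
    have hc' := isGeodesicSegment_ray γ' T
    rw [← h0] at hc'
    obtain ⟨p, q, q', -, -, hqq, hcmp⟩ := CAT0Space.comparison _ _ _ _ _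
      (isGeodesicSegment_ray γ T) hc'
    have h1 := hcmp _ hs _ hs
    have h2 : (Real.toNNReal ((t : ℝ) / T)) * T = t := by
      apply NNReal.eq
      rw [NNReal.coe_mul, Real.coe_toNNReal _ hs.1]
      field_simp
    simp only [h2] at h1
    have h3 : AffineMap.lineMap p q ((t : ℝ) / T) - AffineMap.lineMap p q' ((t : ℝ) / T) =
        ((t : ℝ) / T) • (q - q') := by
      simp only [AffineMap.lineMap_apply_module]
      module
    rw [dist_eq_norm (AffineMap.lineMap p q _), h3, norm_smul, ← dist_eq_norm, hqq,
      Real.norm_of_nonneg hs.1] at h1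
    refine h1.trans ?_
    rw [mul_div_right_comm]
    exact mul_le_mul_of_nonneg_left (hr T) hs.1
  have hlim : Tendsto (fun T : ℝ≥0 => t * r / (T : ℝ)) atTop (𝓝 0) :=
    tendsto_const_nhds.div_atTop (NNReal.tendsto_coe_atTop.2 tendsto_id)
  refine dist_le_zero.1 (ge_of_tendsto hlim ?_)
  filter_upwards [eventually_ge_atTop t, eventually_gt_atTop 0] with T h1 h2 using key T h1 h2

/-- In the coinduced topology it suffices that the preimage in the rays from `a` is closed, and by
`eq_of_asymptotic` that preimage has at most one element. -/
theorem isClosed_singleton_coneTopology {M : Type v} [MetricSpace M] [CAT0Space M] (a : M)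
    (e : Boundary M) : @IsClosed (Boundary M) (coneTopology a) {e} := by
  rw [coneTopology, isClosed_coinduced]
  refine Set.Subsingleton.isClosed fun γ hγ γ' hγ' => Subtype.ext ?_
  exact eq_of_asymptotic (Quotient.exact (Eq.trans hγ (Eq.symm hγ'))) (γ.2.trans γ'.2.symm)

theorem mem_sigmaDyn_iff {G : Type u} [Group G] {M : Type v} [MetricSpace M] [CAT0Space M]
    (a : M) (n : ℕ) {e : Boundary M} (ρ : G →* IsomFixing e) :
    e ∈ SigmaDyn a n ((IsomFixing e).subtype.comp ρ) ↔
      e ∈ SigmaAction n ((IsomFixing e).subtype.comp ρ) := by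
  have h : range (fun g : G => ((IsomFixing e).subtype.comp ρ) g • e) = {e} := by
    have : (fun g : G => ((IsomFixing e).subtype.comp ρ) g • e) = fun _ => e :=
      funext fun g => (ρ g).2
    rw [this, range_const]
  rw [SigmaDyn, mem_ofPred_eq, h,
    @IsClosed.closure_eq _ (coneTopology a) _ (isClosed_singleton_coneTopology a e),
    singleton_subset_iff]

theorem lipschitzWith_busemann {M : Type v} [MetricSpace M] (γ : GeodesicRay M) :
    LipschitzWith 1 (busemann γ) := by
  refine LipschitzWith.of_le_add fun x y => ?_
  refine le_of_tendsto_of_tendsto (tendsto_busemann γ x)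
    ((tendsto_busemann γ y).add_const (dist x y)) (Eventually.of_forall fun t => ?_)
  have := dist_triangle_left y (γ.1 t) x
  simp only
  linarith

/-! ## Barycenters -/

/-- The weighted sum of the squared distances to finitely many points. -/
def sqDistSum {M : Type v} [MetricSpace M] {ι : Type u} (S : Finset ι) (w : ι → ℝ) (p : ι → M)
    (m : M) : ℝ :=
  ∑ i ∈ S, w i * dist m (p i) ^ 2

/-- A single term of positive weight already tends to infinity at infinity, and closed balls are
compact. -/
theorem exists_sqDistSum_min {M : Type v} [MetricSpace M] [ProperSpace M] [Nonempty M]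
    {ι : Type u} {S : Finset ι} {w : ι → ℝ} (hw : ∀ i ∈ S, 0 ≤ w i)
    (hpos : 0 < ∑ i ∈ S, w i) (p : ι → M) : ∃ m, ∀ x, sqDistSum S w p m ≤ sqDistSum S w p x := by
  obtain ⟨i, hi, hwi⟩ : ∃ i ∈ S, 0 < w i := by
    by_contra! h
    exact absurd (Finset.sum_nonpos h) (not_le.2 hpos)
  have hcont : Continuous (sqDistSum S w p) := by
    unfold sqDistSum
    fun_prop
  refine hcont.exists_forall_le ?_
  have h1 : Tendsto (fun x => w i * dist x (p i) ^ 2) (cocompact M) atTop :=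
    ((tendsto_pow_atTop two_ne_zero).comp
      (tendsto_dist_right_cocompact_atTop (p i))).const_mul_atTop hwi
  refine tendsto_atTop_mono (fun x => ?_) h1
  exact Finset.single_le_sum (f := fun i => w i * dist x (p i) ^ 2)
    (fun j hj => mul_nonneg (hw j hj) (sq_nonneg _)) hi

/-- Strong convexity: the CN inequality is summed at the midpoint of `x` and `m`, where the value is
still at least the minimum. Uniqueness and continuity of barycenters both follow from this. -/
theorem sqDistSum_min_add_le {M : Type v} [MetricSpace M] [CAT0Space M]
    {ι : Type u} {S : Finset ι} {w : ι → ℝ} (hw : ∀ i ∈ S, 0 ≤ w i) {p : ι → M} {m : M}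
    (hm : ∀ x, sqDistSum S w p m ≤ sqDistSum S w p x) (x : M) :
    sqDistSum S w p m + (∑ i ∈ S, w i) / 2 * dist x m ^ 2 ≤ sqDistSum S w p x := by
  obtain ⟨c, hc⟩ := exists_midpoint_dist_sq_le x m
  have h1 : sqDistSum S w p c ≤ sqDistSum S w p x / 2 + sqDistSum S w p m / 2 -
      (∑ i ∈ S, w i) / 4 * dist x m ^ 2 := by
    simp only [sqDistSum, Finset.sum_div, Finset.sum_mul, ← Finset.sum_add_distrib,
      ← Finset.sum_sub_distrib]
    refine Finset.sum_le_sum fun i hi => ?_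
    have := mul_le_mul_of_nonneg_left (hc (p i)) (hw i hi)
    linarith
  have h2 := hm c
  linarith

theorem sqDistSum_min_unique {M : Type v} [MetricSpace M] [CAT0Space M]
    {ι : Type u} {S : Finset ι} {w : ι → ℝ} (hw : ∀ i ∈ S, 0 ≤ w i)
    (hpos : 0 < ∑ i ∈ S, w i) {p : ι → M} {m m' : M}
    (hm : ∀ x, sqDistSum S w p m ≤ sqDistSum S w p x)
    (hm' : ∀ x, sqDistSum S w p m' ≤ sqDistSum S w p x) : m = m' := by
  have h1 := sqDistSum_min_add_le hw hm' m
  have h2 := hm m'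
  have h3 : (∑ i ∈ S, w i) / 2 * dist m m' ^ 2 ≤ 0 := by linarith
  have h4 : dist m m' ^ 2 ≤ 0 := nonpos_of_mul_nonpos_right h3 (by linarith)
  exact dist_eq_zero.1 (pow_eq_zero_iff two_ne_zero |>.1 (le_antisymm h4 (sq_nonneg _)))

/-- Barycenters depend Lipschitz-continuously on the weights. -/
theorem dist_sqDistSum_min_le {M : Type v} [MetricSpace M] [CAT0Space M]
    {ι : Type u} {S : Finset ι} {w w' : ι → ℝ} (hw : ∀ i ∈ S, 0 ≤ w i) {p : ι → M} {m m' : M}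
    (hm : ∀ x, sqDistSum S w p m ≤ sqDistSum S w p x)
    (hm' : ∀ x, sqDistSum S w' p m' ≤ sqDistSum S w' p x)
    (hlt : ∑ i ∈ S, |w i - w' i| < (∑ i ∈ S, w i) / 2) :
    dist m' m ≤ (∑ i ∈ S, |w i - w' i| * (2 * dist m (p i))) /
      ((∑ i ∈ S, w i) / 2 - ∑ i ∈ S, |w i - w' i|) := by
  rw [le_div_iff₀ (by linarith)]
  rcases (dist_nonneg : 0 ≤ dist m' m).eq_or_lt with h0 | h0
  · rw [← h0, zero_mul]
    exact Finset.sum_nonneg fun i _ => by positivity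
  have h1 := sqDistSum_min_add_le hw hm m'
  have h2 := hm' m
  -- By `h1` and `h2` the left side is at least (∑ w / 2) · d², where d = `dist m' m`. The upper
  -- bound factors each term as a difference of squares, leaving a factor d to cancel at the end.
  have h3 : sqDistSum S w p m' - sqDistSum S w' p m' + (sqDistSum S w' p m - sqDistSum S w p m) ≤
      ∑ i ∈ S, |w i - w' i| * (dist m' m * (dist m' m + 2 * dist m (p i))) := by
    simp only [sqDistSum, ← Finset.sum_add_distrib, ← Finset.sum_sub_distrib]
    refine Finset.sum_le_sum fun i _ => ?_
    have h4 : w i * dist m' (p i) ^ 2 - w' i * dist m' (p i) ^ 2 +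
        (w' i * dist m (p i) ^ 2 - w i * dist m (p i) ^ 2) =
        (w i - w' i) * ((dist m' (p i) - dist m (p i)) * (dist m' (p i) + dist m (p i))) := by
      ring
    rw [h4]
    refine (le_abs_self _).trans ?_
    rw [abs_mul, abs_mul]
    refine mul_le_mul_of_nonneg_left ?_ (abs_nonneg _)
    have h5 := dist_triangle m' m (p i)
    refine mul_le_mul (abs_dist_sub_le m' m (p i)) ?_ (abs_nonneg _) dist_nonneg
    rw [abs_of_nonneg (by positivity)]
    linarith
  have h6 : ∑ i ∈ S, |w i - w' i| * (dist m' m * (dist m' m + 2 * dist m (p i))) =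
      dist m' m * (dist m' m * ∑ i ∈ S, |w i - w' i| +
        ∑ i ∈ S, |w i - w' i| * (2 * dist m (p i))) := by
    simp only [Finset.mul_sum, ← Finset.sum_add_distrib]
    exact Finset.sum_congr rfl fun i _ => by ring
  refine le_of_mul_le_mul_left ?_ h0
  nlinarith

/-! ## The topology of free cocompact complexes -/

namespace FreeGCW

variable {G : Type u} [Group G] {n : ℕ} (Y : FreeGCW G n)

/-- The cells of all dimensions. -/
abbrev Cell : Type u := Σ m, RelCWComplex.cell (univ : Set Y.X) m

/-- The open cell of a given index. -/
def oc (c : Y.Cell) : Set Y.X := RelCWComplex.openCell (C := (univ : Set Y.X)) c.1 c.2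

/-- The closed cell of a given index. -/
def cc (c : Y.Cell) : Set Y.X := RelCWComplex.closedCell (C := (univ : Set Y.X)) c.1 c.2

variable {Y}

theorem eq_of_oc {c d : Y.Cell} {x : Y.X} (hc : x ∈ Y.oc c) (hd : x ∈ Y.oc d) : c = d :=
  RelCWComplex.eq_of_not_disjoint_openCell (not_disjoint_iff.2 ⟨x, hc, hd⟩)

theorem oc_injective : Function.Injective Y.oc := by
  intro c d h
  obtain ⟨x, hx⟩ := RelCWComplex.openCell_nonempty c.1 c.2
  exact eq_of_oc hx (h ▸ hx)

theorem exists_mem_oc (x : Y.X) : ∃ c, x ∈ Y.oc c := by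
  have h := mem_univ x
  rw [← CWComplex.iUnion_openCell_eq_complex (C := (univ : Set Y.X))] at h
  simp only [mem_iUnion] at h
  obtain ⟨m, j, h⟩ := h
  exact ⟨⟨m, j⟩, h⟩

theorem oc_subset_cc (c : Y.Cell) : Y.oc c ⊆ Y.cc c :=
  RelCWComplex.openCell_subset_closedCell _ _

theorem isCompact_cc (c : Y.Cell) : IsCompact (Y.cc c) :=
  RelCWComplex.isCompact_closedCell

theorem closure_oc (c : Y.Cell) : closure (Y.oc c) = Y.cc c :=
  RelCWComplex.closure_openCell_eq_closedCell

theorem exists_oc_eq_smul (g : G) (c : Y.Cell) : ∃ d, (fun x => g • x) '' Y.oc c = Y.oc d := by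
  obtain ⟨j, hj⟩ := Y.permutes g c.1 c.2
  exact ⟨⟨c.1, j⟩, hj⟩

theorem cc_eq_smul {g : G} {c d : Y.Cell} (h : (fun x => g • x) '' Y.oc c = Y.oc d) :
    (fun x => g • x) '' Y.cc c = Y.cc d := by
  rw [← closure_oc, ← closure_oc, ← h]
  exact (Homeomorph.smul g).image_closure _

theorem smul_eq_of_oc {g g' : G} {c d : Y.Cell} (h : (fun x => g • x) '' Y.oc c = Y.oc d)
    (h' : (fun x => g' • x) '' Y.oc c = Y.oc d) : g = g' := by
  have : g'⁻¹ * g = 1 := by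
    refine Y.free _ c.1 c.2 ?_
    change (fun x => (g'⁻¹ * g) • x) '' Y.oc c = Y.oc c
    have h2 : (fun x : Y.X => (g'⁻¹ * g) • x) = (fun x => g'⁻¹ • x) ∘ fun x => g • x :=
      funext fun x => mul_smul _ _ _
    rw [h2, image_comp, h, ← h', ← image_comp]
    simp
  exact (inv_mul_eq_one.1 this).symm

/-- A closed cell meets only finitely many open cells. -/
theorem finite_oc_inter_cc (c : Y.Cell) : {d | (Y.oc d ∩ Y.cc c).Nonempty}.Finite := by
  obtain ⟨m, i⟩ := c
  obtain ⟨I, hI⟩ := CWComplex.cellFrontier_subset_finite_openCell m i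
  have hfin : (⋃ k ∈ Finset.range m, (fun j => (⟨k, j⟩ : Y.Cell)) '' (I k : Set _)).Finite :=
    (Finset.range m).finite_toSet.biUnion fun k _ => (I k).finite_toSet.image _
  refine (hfin.insert ⟨m, i⟩).subset ?_
  rintro d ⟨x, hxd, hxc⟩
  have hxc' : x ∈ RelCWComplex.closedCell (C := (univ : Set Y.X)) m i := hxc
  rw [← RelCWComplex.cellFrontier_union_openCell_eq_closedCell] at hxc'
  rcases hxc' with hx | hx
  · right
    have := hI hx
    simp only [mem_iUnion] at this
    obtain ⟨k, hk, j, hj, hx⟩ := this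
    have hdk : d = ⟨k, j⟩ := eq_of_oc hxd hx
    simp only [mem_iUnion]
    exact ⟨k, Finset.mem_range.2 hk, j, hj, hdk.symm⟩
  · left
    exact eq_of_oc hxd hx

theorem exists_finite_representatives (Y : FreeGCW G n) : ∃ F : Set Y.Cell, F.Finite ∧
    ∀ c, ∃ d ∈ F, ∃ g : G, (fun x => g • x) '' Y.oc d = Y.oc c := by
  choose F hF hF' using Y.cocompact
  refine ⟨⋃ m ∈ Finset.range (n + 1), (fun j => (⟨m, j⟩ : Y.Cell)) '' F m,
    (Finset.range (n + 1)).finite_toSet.biUnion fun k _ => (hF k).image _, ?_⟩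
  rintro ⟨m, i⟩
  have hm : m < n + 1 := by
    by_contra h
    exact (Y.dim_le m (by omega)).false i
  obtain ⟨j, hj, g, hg⟩ := hF' m i
  refine ⟨⟨m, j⟩, ?_, g, hg.symm⟩
  simp only [mem_iUnion]
  exact ⟨m, Finset.mem_range.2 hm, j, hj, rfl⟩

/-- A common point lies in an open cell `a` meeting `cc d` and comes from an open cell `b` meeting
`cc c`. There are finitely many such pairs, and by freeness each determines `g`. -/
theorem finite_smul_cc_inter_cc (c d : Y.Cell) :
    {g : G | ((fun x => g • x) '' Y.cc c ∩ Y.cc d).Nonempty}.Finite := by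
  have hfin : (⋃ a ∈ {a | (Y.oc a ∩ Y.cc d).Nonempty}, ⋃ b ∈ {b | (Y.oc b ∩ Y.cc c).Nonempty},
      {g : G | (fun x => g • x) '' Y.oc b = Y.oc a}).Finite :=
    (finite_oc_inter_cc d).biUnion fun a _ => (finite_oc_inter_cc c).biUnion fun b _ =>
      Set.Subsingleton.finite fun g hg g' hg' => smul_eq_of_oc hg hg'
  refine hfin.subset ?_
  rintro g ⟨_, ⟨y, hy, rfl⟩, hyd⟩
  obtain ⟨b, hb⟩ := exists_mem_oc y
  obtain ⟨a, ha⟩ := exists_oc_eq_smul g b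
  simp only [mem_iUnion]
  exact ⟨a, ⟨g • y, ha ▸ mem_image_of_mem _ hb, hyd⟩, b, ⟨y, hb, hy⟩, ha⟩

/-- Local finiteness, which fails for general CW-complexes: every cell is a translate of one of
finitely many representatives, and each of these has finitely many translates meeting `cc c`. -/
theorem finite_cc_inter_cc (c : Y.Cell) : {d | (Y.cc d ∩ Y.cc c).Nonempty}.Finite := by
  obtain ⟨F, hF, hF'⟩ := exists_finite_representatives Y
  have hfin : (⋃ f ∈ F, ⋃ g ∈ {g : G | ((fun x => g • x) '' Y.cc f ∩ Y.cc c).Nonempty},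
      {d | (fun x => g • x) '' Y.oc f = Y.oc d}).Finite :=
    hF.biUnion fun f _ => (finite_smul_cc_inter_cc f c).biUnion fun g _ =>
      Set.Subsingleton.finite fun d hd d' hd' => oc_injective (Eq.trans (Eq.symm hd) hd')
  refine hfin.subset fun d hd => ?_
  obtain ⟨f, hf, g, hg⟩ := hF' d
  simp only [mem_iUnion]
  refine ⟨f, hf, g, ?_, hg⟩
  rw [mem_ofPred_eq, cc_eq_smul hg]
  exact hd

/-- Closedness is tested on each closed cell, where by local finiteness only finitely many members
of the union matter. -/
theorem isClosed_biUnion_cc (A : Set Y.Cell) : IsClosed (⋃ d ∈ A, Y.cc d) := by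
  rw [CWComplex.closed (univ : Set Y.X) _ (subset_univ _)]
  intro m j
  have h : (⋃ d ∈ A, Y.cc d) ∩ Y.cc ⟨m, j⟩ =
      ⋃ d ∈ A ∩ {d | (Y.cc d ∩ Y.cc ⟨m, j⟩).Nonempty}, Y.cc d ∩ Y.cc ⟨m, j⟩ := by
    ext x
    simp only [mem_inter_iff, mem_iUnion, exists_prop, mem_ofPred_eq]
    constructor
    · rintro ⟨⟨d, hd, hx⟩, hx'⟩
      exact ⟨d, ⟨hd, x, hx, hx'⟩, hx, hx'⟩
    · rintro ⟨d, ⟨hd, -⟩, hx, hx'⟩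
      exact ⟨⟨d, hd, hx⟩, hx'⟩
  change IsClosed ((⋃ d ∈ A, Y.cc d) ∩ Y.cc ⟨m, j⟩)
  rw [h]
  exact ((finite_cc_inter_cc _).inter_of_right A).isClosed_biUnion fun d _ =>
    ((isCompact_cc d).inter (isCompact_cc _)).isClosed

/-- Every point has a neighbourhood covered by finitely many closed cells. -/
theorem exists_mem_nhds_subset_cc (x : Y.X) :
    ∃ A : Set Y.Cell, A.Finite ∧ (⋃ d ∈ A, Y.cc d) ∈ 𝓝 x := by
  obtain ⟨c, hc⟩ := exists_mem_oc x
  refine ⟨{d | x ∈ Y.cc d}, (finite_cc_inter_cc c).subset fun d hd =>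
    ⟨x, hd, oc_subset_cc c hc⟩, ?_⟩
  -- The union of the closed cells missing `x` is closed; its complement is a neighbourhood of `x`
  -- covered by the closed cells containing `x`.
  refine mem_of_superset ((isClosed_biUnion_cc {d | x ∉ Y.cc d}).isOpen_compl.mem_nhds ?_) ?_
  · simp
  · intro y hy
    obtain ⟨d, hd⟩ := exists_mem_oc y
    simp only [mem_compl_iff, mem_iUnion, mem_ofPred_eq, not_exists, exists_prop, not_and] at hy ⊢
    exact ⟨d, by_contra fun h => hy d h (oc_subset_cc d hd), oc_subset_cc d hd⟩

instance : LocallyCompactSpace Y.X :=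
  have : WeaklyLocallyCompactSpace Y.X := ⟨fun x => by
    obtain ⟨A, hA, hx⟩ := exists_mem_nhds_subset_cc x
    exact ⟨_, hA.isCompact_biUnion fun d _ => isCompact_cc d, hx⟩⟩
  inferInstance

theorem exists_finite_cover {T : Set Y.X} (hT : IsCompact T) :
    ∃ A : Set Y.Cell, A.Finite ∧ T ⊆ ⋃ d ∈ A, Y.cc d := by
  refine hT.induction_on ⟨∅, finite_empty, empty_subset _⟩
    (fun s t hst ⟨A, hA, h⟩ => ⟨A, hA, hst.trans h⟩) ?_ ?_
  · rintro s t ⟨A, hA, h⟩ ⟨B, hB, h'⟩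
    refine ⟨A ∪ B, hA.union hB, ?_⟩
    rw [biUnion_union]
    exact union_subset_union h h'
  · intro x _
    obtain ⟨A, hA, hx⟩ := exists_mem_nhds_subset_cc x
    exact ⟨_, mem_nhdsWithin_of_mem_nhds hx, A, hA, Subset.rfl⟩

/-- The action of `G` on `Y` is properly discontinuous. -/
theorem finite_smul_inter {S T : Set Y.X} (hS : IsCompact S) (hT : IsCompact T) :
    {g : G | ((fun x => g • x) '' S ∩ T).Nonempty}.Finite := by
  obtain ⟨A, hA, hSA⟩ := exists_finite_cover hS
  obtain ⟨B, hB, hTB⟩ := exists_finite_cover hT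
  refine (hA.biUnion fun a _ => hB.biUnion fun b _ => finite_smul_cc_inter_cc a b).subset ?_
  rintro g ⟨_, ⟨y, hy, rfl⟩, hyT⟩
  have h1 := hSA hy
  have h2 := hTB hyT
  simp only [mem_iUnion, exists_prop] at h1 h2 ⊢
  obtain ⟨a, ha, h1⟩ := h1
  obtain ⟨b, hb, h2⟩ := h2
  exact ⟨a, ha, b, hb, g • y, mem_image_of_mem _ h1, h2⟩

/-- `G` acts cocompactly on `Y`. -/
theorem exists_isCompact_cover (Y : FreeGCW G n) :
    ∃ K : Set Y.X, IsCompact K ∧ ∀ x, ∃ g : G, g • x ∈ K := by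
  obtain ⟨F, hF, hF'⟩ := exists_finite_representatives Y
  refine ⟨⋃ f ∈ F, Y.cc f, hF.isCompact_biUnion fun f _ => isCompact_cc f, fun x => ?_⟩
  obtain ⟨c, hc⟩ := exists_mem_oc x
  obtain ⟨f, hf, g, hg⟩ := hF' c
  rw [← hg] at hc
  obtain ⟨y, hy, rfl⟩ := hc
  refine ⟨g⁻¹, ?_⟩
  simp only [inv_smul_smul, mem_iUnion]
  exact ⟨f, hf, oc_subset_cc f hy⟩

theorem exists_abs_le_of_invariant (Y : FreeGCW G n) {f : Y.X → ℝ} (hf : Continuous f)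
    (hinv : ∀ (g : G) x, f (g • x) = f x) : ∃ C, ∀ x, |f x| ≤ C := by
  obtain ⟨K, hK, hGK⟩ := exists_isCompact_cover Y
  obtain ⟨C, hC⟩ := hK.exists_bound_of_continuousOn hf.continuousOn
  refine ⟨C, fun x => ?_⟩
  obtain ⟨g, hg⟩ := hGK x
  rw [← hinv g]
  exact hC _ hg

end FreeGCW

/-! ## Existence of control functions -/

/-- A free cocompact `G`-complex admits a `G`-map to every proper CAT(0) space on which `G` acts:
send `x` to a barycenter of an orbit, with weights given by a bump function. -/
theorem exists_isControl {G : Type u} [Group G] {M : Type v} [MetricSpace M] [ProperSpace M]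
    [CAT0Space M] [Nonempty M] {n : ℕ} (ρ : G →* (M ≃ᵢ M)) (Y : FreeGCW G n) :
    ∃ h : C(Y.X, M), IsControl ρ Y h := by
  let m₀ : M := Classical.arbitrary M
  obtain ⟨K, hK, hGK⟩ := FreeGCW.exists_isCompact_cover Y
  obtain ⟨φ, hφK, -, hφc, hφ⟩ := exists_continuous_one_zero_of_isCompact hK isClosed_empty
    (disjoint_empty K)
  -- Proper discontinuity makes one finite index set serve a whole neighbourhood of `x₀`.
  have hloc : ∀ x₀ : Y.X, ∃ S : Finset G, ∀ᶠ x in 𝓝 x₀, ∀ g, φ (g⁻¹ • x) ≠ 0 → g ∈ S := by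
    intro x₀
    obtain ⟨B, hB, hx₀⟩ := exists_compact_mem_nhds x₀
    refine ⟨(FreeGCW.finite_smul_inter hφc.isCompact hB).toFinset, ?_⟩
    filter_upwards [hx₀] with x hx g hg
    rw [Set.Finite.mem_toFinset]
    exact ⟨x, ⟨g⁻¹ • x, subset_tsupport _ hg, smul_inv_smul g x⟩, hx⟩
  have hpos : ∀ (x : Y.X) (S : Finset G), (∀ g, φ (g⁻¹ • x) ≠ 0 → g ∈ S) →
      0 < ∑ g ∈ S, φ (g⁻¹ • x) := by
    intro x S hS
    obtain ⟨g, hg⟩ := hGK x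
    have h1 : φ (g⁻¹⁻¹ • x) = 1 := by
      rw [inv_inv]
      exact hφK hg
    exact Finset.sum_pos' (fun i _ => (hφ _).1) ⟨g⁻¹, hS _ (h1 ▸ one_ne_zero), h1 ▸ one_pos⟩
  -- Summing over all of `G` keeps `E` independent of the local choice of `S`, so that equivariance
  -- is a mere reindexing.
  let E : Y.X → M → ℝ := fun x m => ∑ᶠ g : G, φ (g⁻¹ • x) * dist m (ρ g m₀) ^ 2
  have hE : ∀ (x : Y.X) (S : Finset G), (∀ g, φ (g⁻¹ • x) ≠ 0 → g ∈ S) →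
      E x = sqDistSum S (fun g => φ (g⁻¹ • x)) (fun g => ρ g m₀) := by
    intro x S hS
    funext m
    exact finsum_eq_sum_of_support_subset _ fun g hg => hS g (left_ne_zero_of_mul hg)
  have hmin : ∀ x, ∃ m, ∀ m', E x m ≤ E x m' := by
    intro x
    obtain ⟨S, hS⟩ := hloc x
    rw [hE x S hS.self_of_nhds]
    exact exists_sqDistSum_min (fun g _ => (hφ _).1) (hpos x S hS.self_of_nhds) _
  have huniq : ∀ x m m', (∀ z, E x m ≤ E x z) → (∀ z, E x m' ≤ E x z) → m = m' := by
    intro x m m'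
    obtain ⟨S, hS⟩ := hloc x
    rw [hE x S hS.self_of_nhds]
    exact sqDistSum_min_unique (fun g _ => (hφ _).1) (hpos x S hS.self_of_nhds)
  choose h hh using hmin
  have hequiv : ∀ (k : G) x m, E (k • x) (ρ k m) = E x m := by
    intro k x m
    change ∑ᶠ g : G, _ = ∑ᶠ g : G, _
    rw [← finsum_comp_equiv (Equiv.mulLeft k)]
    refine finsum_congr fun g => ?_
    simp [mul_smul, (ρ k).dist_eq]
  have hcont : Continuous h := by
    rw [continuous_iff_continuousAt]
    intro x₀
    obtain ⟨S, hS⟩ := hloc x₀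
    have hS₀ := hS.self_of_nhds
    have hw : ∀ g : G, Continuous fun x => |φ (g⁻¹ • x₀) - φ (g⁻¹ • x)| := fun g =>
      (continuous_const.sub (φ.continuous.comp (continuous_const_smul _))).abs
    have h1 : Tendsto (fun x => ∑ g ∈ S, |φ (g⁻¹ • x₀) - φ (g⁻¹ • x)|) (𝓝 x₀) (𝓝 0) := by
      have := (continuous_finsetSum S fun g _ => hw g).tendsto x₀
      simpa using this
    have h2 : Tendsto (fun x => ∑ g ∈ S, |φ (g⁻¹ • x₀) - φ (g⁻¹ • x)| *
        (2 * dist (h x₀) (ρ g m₀))) (𝓝 x₀) (𝓝 0) := by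
      have := (continuous_finsetSum S fun g _ =>
        (hw g).mul_const (2 * dist (h x₀) (ρ g m₀))).tendsto x₀
      simpa using this
    have hW : 0 < (∑ g ∈ S, φ (g⁻¹ • x₀)) / 2 := half_pos (hpos x₀ S hS₀)
    have h3 := h2.div (h1.const_sub ((∑ g ∈ S, φ (g⁻¹ • x₀)) / 2)) (by simpa using hW.ne')
    -- `h3` concerns the bound of `dist_sqDistSum_min_le`: its numerator tends to 0 and its
    -- denominator to half the total weight at `x₀`, which is positive.
    rw [zero_div] at h3
    rw [ContinuousAt, tendsto_iff_dist_tendsto_zero]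
    refine squeeze_zero' (Eventually.of_forall fun _ => dist_nonneg) ?_ h3
    filter_upwards [hS, h1.eventually_lt_const hW] with x hx hlt
    refine dist_sqDistSum_min_le (w' := fun g => φ (g⁻¹ • x)) (fun g _ => (hφ _).1) ?_ ?_ hlt
    · rw [← hE x₀ S hS₀]
      exact hh x₀
    · rw [← hE x S hx]
      exact hh x
  -- Both `h (k • x)` and `ρ k (h x)` minimise `E (k • x)`.
  refine ⟨⟨h, hcont⟩, fun k x => huniq (k • x) _ _ (hh _) fun z => ?_⟩
  obtain ⟨z, rfl⟩ := (ρ k).surjective z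
  change E (k • x) (ρ k (h x)) ≤ _
  rw [hequiv, hequiv]
  exact hh x z

/-! ## Comparison of filtrations -/

theorem largestSubcomplex_mono {X : Type u} [TopologicalSpace X] [CWComplex (univ : Set X)]
    {A B : Set X} (h : A ⊆ B) : largestSubcomplex A ⊆ largestSubcomplex B :=
  iUnion₂_subset fun E hE => subset_iUnion₂_of_subset E (hE.trans h) Subset.rfl

theorem largestSubcomplex_subset {X : Type u} [TopologicalSpace X] [CWComplex (univ : Set X)]
    (A : Set X) : largestSubcomplex A ⊆ A :=
  iUnion₂_subset fun _ hE => hE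

theorem SpheresFill.mono {X : Type u} [TopologicalSpace X] {p : ℕ} {A A' B B' : Set X}
    (h : SpheresFill p A B) (hA : A' ⊆ A) (hB : B ⊆ B') : SpheresFill p A' B' := by
  intro f hf
  obtain ⟨F, hF, hF'⟩ := h f fun x => hA (hf x)
  exact ⟨F, fun x => hB (hF x), hF'⟩

/-- Controlled connectivity only depends on the height function `β_γ ∘ h`, up to positive
scaling and bounded changes. -/
theorem IsCCInDirection.of_abs_sub_le {G : Type u} [Group G] {M M' : Type*} [MetricSpace M]
    [MetricSpace M'] {n : ℕ} {Y : FreeGCW G n} {h : C(Y.X, M)} {h' : C(Y.X, M')}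
    {γ : GeodesicRay M} {γ' : GeodesicRay M'} (H : IsCCInDirection Y h γ) {c C : ℝ} (hc : 0 < c)
    (hC : ∀ x, |c * busemann γ (h x) - busemann γ' (h' x)| ≤ C) : IsCCInDirection Y h' γ' := by
  have h1 : ∀ s, overHoroball Y h γ s ⊆ overHoroball Y h' γ' (c * s - C) := fun s =>
    largestSubcomplex_mono fun x (hx : s ≤ busemann γ (h x)) => by
      change c * s - C ≤ busemann γ' (h' x)
      have := mul_le_mul_of_nonneg_left hx hc.le
      linarith [abs_le.1 (hC x)]
  have h2 : ∀ s, overHoroball Y h' γ' s ⊆ overHoroball Y h γ ((s - C) / c) := fun s =>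
    largestSubcomplex_mono fun x (hx : s ≤ busemann γ' (h' x)) => by
      change (s - C) / c ≤ busemann γ (h x)
      rw [div_le_iff₀' hc]
      linarith [abs_le.1 (hC x)]
  obtain ⟨H1, H2⟩ := H
  have hC0 : 0 ≤ C := (abs_nonneg _).trans (hC Y.nonempty.some)
  refine ⟨fun s => ?_, fun s p hp => ?_⟩
  · obtain ⟨x, hx⟩ := H1 ((s + C) / c)
    have := h1 _ hx
    rw [mul_div_cancel₀ _ hc.ne', add_sub_cancel_right] at this
    exact ⟨x, this⟩
  · obtain ⟨lag, hlag, hfill⟩ := H2 ((s - C) / c) p hp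
    -- One `C` is lost in passing to the filtration of `h` and another in coming back.
    refine ⟨c * lag + 2 * C, by positivity, hfill.mono (h2 s) ?_⟩
    have := h1 ((s - C) / c - lag)
    rwa [mul_sub, mul_div_cancel₀ _ hc.ne',
      show s - C - c * lag - C = s - (c * lag + 2 * C) by ring] at this

/-- This is the case p = -1 of the connectivity condition, and it is what excludes the zero
character. -/
theorem IsCCInDirection.not_bddAbove {G : Type u} [Group G] {M : Type v} [MetricSpace M]
    {n : ℕ} {Y : FreeGCW G n} {h : C(Y.X, M)} {γ : GeodesicRay M} (H : IsCCInDirection Y h γ)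
    (C : ℝ) : ∃ x, C < busemann γ (h x) := by
  obtain ⟨x, hx⟩ := H.1 (C + 1)
  have : C + 1 ≤ busemann γ (h x) :=
    largestSubcomplex_subset (h ⁻¹' horoball γ (C + 1)) hx
  exact ⟨x, by linarith⟩

/-! ## The Euclidean line -/

theorem busemann_of_endpoint_eq_lineInfty {γ : GeodesicRay ℝ} (h : endpoint γ = lineInfty)
    (b : ℝ) : busemann γ b = b - γ.1 0 := by
  obtain ⟨r, hr⟩ : Asymptotic γ _ := Quotient.exact h
  refine tendsto_nhds_unique (tendsto_busemann γ b) (tendsto_const_nhds.congr' ?_)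
  have hcoe : Tendsto (fun t : ℝ≥0 => (t : ℝ)) atTop atTop := NNReal.tendsto_coe_atTop.2 tendsto_id
  -- From these times on, γ(t) ≥ t - r lies to the right of both `b` and γ(0), so the absolute
  -- values open up and the expression is constant.
  filter_upwards [hcoe.eventually_ge_atTop (r + b), hcoe.eventually_ge_atTop (r + γ.1 0)]
    with t h1 h2
  have h3 : |γ.1 t - t| ≤ r := hr t
  have h4 := (abs_le.1 h3).1
  rw [Real.dist_eq, Real.dist_eq, abs_of_nonpos (by linarith), abs_of_nonpos (by linarith)]
  ring

/-! ## The theorem -/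

theorem busemann_smul {G : Type u} [Group G] {M : Type v} [MetricSpace M] [CAT0Space M]
    {n : ℕ} {e : Boundary M} {ρ : G →* IsomFixing e} {Y : FreeGCW G n} {h : C(Y.X, M)}
    (hh : IsControl ((IsomFixing e).subtype.comp ρ) Y h) {γ : GeodesicRay M}
    (hγ : endpoint γ = e) (g : G) (x : Y.X) :
    busemann γ (h (g • x)) = busemann γ (h x) + inducedCharacter ρ (Additive.ofMul g) := by
  rw [hh]
  exact busemann_kappa (ρ g) hγ (h x)

theorem mem_sigmaAction_iff {G : Type u} [Group G] {M : Type v} [MetricSpace M] [ProperSpace M]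
    [CAT0Space M] (n : ℕ) {e : Boundary M} (ρ : G →* IsomFixing e) :
    e ∈ SigmaAction n ((IsomFixing e).subtype.comp ρ) ↔
      ∃ h : inducedCharacter ρ ≠ 0, rayOfNeZero ℝ (inducedCharacter ρ) h ∈ SigmaGroup n G := by
  constructor
  · rintro ⟨Y, h, γ, hh, hγ, hcc⟩
    have hβ := (lipschitzWith_busemann γ).continuous.comp h.continuous
    have hχ : inducedCharacter ρ ≠ 0 := by
      intro h0
      obtain ⟨C, hC⟩ := Y.exists_abs_le_of_invariant hβ fun g x => by
        simp [busemann_smul hh hγ, h0]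
      obtain ⟨x, hx⟩ := hcc.not_bddAbove C
      exact absurd ((le_abs_self _).trans (hC x)) (not_le.2 hx)
    -- The height itself serves as control function to the line. The standard ray starts at 0, so
    -- the two heights agree exactly and `C = 0` works.
    refine ⟨hχ, _, hχ, rfl, Y, ⟨_, hβ⟩, _, fun g x => ?_, rfl,
      hcc.of_abs_sub_le one_pos (C := 0) fun x => ?_⟩
    · exact (busemann_smul hh hγ g x).trans (add_comm _ _)
    · rw [busemann_of_endpoint_eq_lineInfty rfl]
      simp
  · rintro ⟨hχ, χ', hχ', heq, Y, h', γ', hh', hγ', hcc⟩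
    obtain ⟨γ, hγ⟩ := Quotient.exists_rep e
    have : Nonempty M := ⟨γ.1 0⟩
    obtain ⟨h, hh⟩ := exists_isControl ((IsomFixing e).subtype.comp ρ) Y
    obtain ⟨r₁, r₂, hr₁, hr₂, hr⟩ := ((ray_eq_iff hχ hχ').1 heq).exists_pos hχ hχ'
    have hβ := (lipschitzWith_busemann γ).continuous.comp h.continuous
    have hβ' := (lipschitzWith_busemann γ').continuous.comp h'.continuous
    -- Since r₁χ = r₂χ', the factor `r₂ / r₁` turns χ' into χ, and both heights then change by χ(g)
    -- under `g`.
    obtain ⟨C, hC⟩ := Y.exists_abs_le_of_invariant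
      (f := fun x => r₂ / r₁ * busemann γ' (h' x) - busemann γ (h x))
      ((continuous_const.mul hβ').sub hβ) fun g x => by
        have h1 : r₁ * inducedCharacter ρ (Additive.ofMul g) = r₂ * χ' (Additive.ofMul g) :=
          DFunLike.congr_fun hr (Additive.ofMul g)
        have h2 : h' (g • x) = χ' (Additive.ofMul g) + h' x := hh' g x
        rw [busemann_smul hh hγ, busemann_of_endpoint_eq_lineInfty hγ',
          busemann_of_endpoint_eq_lineInfty hγ', h2]
        field_simp
        linarith
    exact ⟨Y, h, γ, hh, hγ, hcc.of_abs_sub_le (div_pos hr₂ hr₁) hC⟩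

end GeomInv

theorem theoremI {G : Type*} [Group G] {M : Type*} [MetricSpace M] [ProperSpace M]
    [CAT0Space M] (n : ℕ) (e : Boundary M) (ρ : G →* IsomFixing e) (a : M) :
    (e ∈ SigmaAction n ((IsomFixing e).subtype.comp ρ) ↔
      ∃ h : inducedCharacter ρ ≠ 0, rayOfNeZero ℝ (inducedCharacter ρ) h ∈ SigmaGroup n G) ∧
    (e ∈ SigmaDyn a n ((IsomFixing e).subtype.comp ρ) ↔
      e ∈ SigmaAction n ((IsomFixing e).subtype.comp ρ)) :=
  ⟨mem_sigmaAction_iff n ρ, mem_sigmaDyn_iff a n ρ⟩
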